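/- Let $G=\langle S\mid T\rangle$ be a finite presentation of a (Gromov) hyperbolic group, and write $\overline w\in G$ for the element represented by a word $w$ over $S\sqcup S^{-1}$, and $w^{-1}$ for the formal inverse word. Let $\mathcal L\subseteq (S\sqcup S^{-1})^*$ be a regular language, closed under prefixes and suffixes and consisting of geodesic words of $G$, such that for every $n\ge 1$ the set $\mathcal L_n$ of words of length $n$ in $\mathcal L$ generates a finite-index subgroup of $G$. For a finite set $R$ of triples $(x,y,z)$ of nonempty reduced words of $\mathcal L$ such that $xyz$ is reduced without cancellation and lies in $\mathcal L$, let $\mathcal W(R)$ be the set of all words $x,y,z$ occurring in triples of $R$, and let $\Upsilon(R)$ be the directed multigraph with vertex set $V(R)=\mathcal W(R)\cup\mathcal W(R)^{-1}$ in which each triple $(x,y,z)\in R$ contributes the two directed edges $(x,z^{-1})$ and $(z^{-1},x)$. Let $A$ be its (symmetric) adjacency matrix, counting edges with multiplicity, $\deg(w)$ the number of edges starting at the vertex $w$, $D$ the diagonal matrix of degrees, and let $\lambda_0\le\lambda_1\le\cdots$ be the eigenvalues, with multiplicity, of $I-D^{-1/2}AD^{-1/2}$ (where an entry $0$ of $D$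 gives an entry $0$ of $D^{-1/2}$); put $\lambda_1(\Upsilon(R))=\lambda_1$. For $w\in V(R)$ let $\mathrm{rep}(w)=|\{(u,w,v)\in R\}|+|\{(u,w^{-1},v)\in R\}|$, and for $g\in G$ let $\deg(g)=\sum_{w\in V(R),\,\overline w=g}\deg(w)$ and $\mathrm{rep}(g)=\sum_{w\in V(R),\,\overline w=g}\mathrm{rep}(w)$. Let $\omega:\mathbb N\to\mathbb R$ be a function, and for each $l\ge1$ let $R_l$ be a finite set of triples as above such that for each $(x,y,z)\in R_l$ the words $x,y,z$ have length between $l/3-\omega(l)/3$ and $l/3+2$, and $xyz$ has length between $l-\omega(l)$ and $l$. Let $\mathcal R_l=\{xyz:(x,y,z)\in R_l\}$. Suppose that $\mathcal L_{\lfloor l/3\rfloor}\subseteq V(R_l)$ for all sufficiently large $l$, and that, with $\deg$ and $\mathrm{rep}$ computed with respect to $R_l$, $$\deg(g)=(1+o_l(1))\deg(g^{-1})=(1+o_l(1))\,\mathrm{rep}(g)$$ for all $g\in G$ represented by a vertex of $\Upsilon(R_l)$, where the $o_l(1)$ terms tend to $0$ as $l\to\infty$ uniformly in $g$. If $\lim_{l\to\infty}\lambda_1(\Upsilon(R_l))$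 exists and is greater than $1/2$, then $G/\langle\langle\mathcal R_l\rangle\rangle$ has Property (T) for all sufficiently large $l$. -/

import Mathlib

open Filter Topology

universe v u

namespace HypQuot

/-! ### Words and the presented group -/

/-- Words in the formal alphabet `S ⊔ S⁻¹`; `(s, true)` is the letter `s`, `(s, false)` is the
letter `s⁻¹`.  The formal inverse of a word `w` is `FreeGroup.invRev w`, and `w` is reduced when
`FreeGroup.IsReduced w`. -/
abbrev Word (S : Type*) := List (S × Bool)

/-- A triple of words `(x, y, z)`. -/
abbrev Triple (S : Type*) := Word S × Word S × Word S

/-- The concatenation `xyz` of a triple. -/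
def Triple.concat {S : Type*} (r : Triple S) : Word S := r.1 ++ r.2.1 ++ r.2.2

/-- The element of `G = ⟨S | T⟩` represented by a word. -/
def eval {S : Type*} (T : Set (FreeGroup S)) (w : Word S) : PresentedGroup T :=
  PresentedGroup.mk T (FreeGroup.mk w)

/-- The word length of `g` with respect to `S`. -/
noncomputable def wordNorm {S : Type*} (T : Set (FreeGroup S)) (g : PresentedGroup T) : ℕ :=
  sInf {n | ∃ w : Word S, eval T w = g ∧ w.length = n}

/-- The word metric. -/
noncomputable def wordDist {S : Type*} (T : Set (FreeGroup S)) (g h : PresentedGroup T) : ℕ :=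
  wordNorm T (g⁻¹ * h)

/-- Gromov hyperbolicity of `⟨S | T⟩` with its word metric, by the four-point condition. -/
def IsHyperbolic {S : Type*} (T : Set (FreeGroup S)) : Prop :=
  ∃ δ : ℕ, ∀ a b c d : PresentedGroup T,
    wordDist T a b + wordDist T c d ≤
      max (wordDist T a c + wordDist T b d) (wordDist T a d + wordDist T b c) + δ

/-- A word is geodesic when no shorter word represents the same element. -/
def IsGeodesic {S : Type*} (T : Set (FreeGroup S)) (w : Word S) : Prop :=
  ∀ w' : Word S, eval T w' = eval T w → w.length ≤ w'.length

/-- The standing assumptions on the language: regular, closed under prefixes and suffixes,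
consisting of geodesic words, and for each `n ≥ 1` its words of length `n` generate a subgroup of
finite index. -/
structure IsAdmissibleLanguage {S : Type*} (T : Set (FreeGroup S)) (L : Language (S × Bool)) :
    Prop where
  regular : L.IsRegular
  prefix_closed : ∀ u v : Word S, u ++ v ∈ L → u ∈ L
  suffix_closed : ∀ u v : Word S, u ++ v ∈ L → v ∈ L
  geodesic : ∀ w ∈ L, IsGeodesic T w
  finiteIndex : ∀ n : ℕ, 1 ≤ n →
    (Subgroup.closure (eval T '' {w | w ∈ L ∧ w.length = n})).FiniteIndex

/-- `R` is a finite set of triples of nonempty reduced words of the language `L` such that each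
`xyz` is reduced without cancellation and lies in `L`. -/
structure IsTripleSet {S : Type*} (L : Language (S × Bool)) (R : Finset (Triple S)) : Prop where
  mem : ∀ r ∈ R, r.1 ∈ L ∧ r.2.1 ∈ L ∧ r.2.2 ∈ L
  ne_nil : ∀ r ∈ R, r.1 ≠ [] ∧ r.2.1 ≠ [] ∧ r.2.2 ≠ []
  reduced : ∀ r ∈ R, FreeGroup.IsReduced r.1 ∧ FreeGroup.IsReduced r.2.1 ∧
    FreeGroup.IsReduced r.2.2
  concat_reduced : ∀ r ∈ R, FreeGroup.IsReduced r.concat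
  concat_mem : ∀ r ∈ R, r.concat ∈ L

/-! ### The graph `Υ` -/

section Graph

variable {S : Type*} [DecidableEq S] (R : Finset (Triple S))

/-- The set `W(R)` of all words occurring in a triple of `R`. -/
def words : Finset (Word S) := R.biUnion fun r => {r.1, r.2.1, r.2.2}

/-- The vertex set `W(R) ∪ W(R)⁻¹` of `Υ`. -/
def verts : Finset (Word S) := words R ∪ (words R).image FreeGroup.invRev

/-- The number of directed edges of `Υ` from `u` to `v`: each triple `(x, y, z) ∈ R` contributes
one directed edge `(x, z⁻¹)` and one directed edge `(z⁻¹, x)`. -/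
def edgeCount (u v : Word S) : ℕ :=
  (R.filter fun r => r.1 = u ∧ FreeGroup.invRev r.2.2 = v).card +
    (R.filter fun r => FreeGroup.invRev r.2.2 = u ∧ r.1 = v).card

/-- The degree of a vertex: the number of directed edges of `Υ` starting at it. -/
def deg (w : Word S) : ℕ := ∑ v ∈ verts R, edgeCount R w v

/-- The number of occurrences of `w` and of `w⁻¹` as the middle word of a triple. -/
def rep (w : Word S) : ℕ :=
  (R.filter fun r => r.2.1 = w).card + (R.filter fun r => r.2.1 = FreeGroup.invRev w).card

open Classical in
/-- `deg(g)` for a group element: the sum of `deg(w)` over the vertices `w` that represent `g`. -/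
noncomputable def degElt (T : Set (FreeGroup S)) (g : PresentedGroup T) : ℕ :=
  ∑ w ∈ (verts R).filter (fun w => eval T w = g), deg R w

open Classical in
/-- `rep(g)` for a group element: the sum of `rep(w)` over the vertices `w` that represent `g`. -/
noncomputable def repElt (T : Set (FreeGroup S)) (g : PresentedGroup T) : ℕ :=
  ∑ w ∈ (verts R).filter (fun w => eval T w = g), rep R w

/-- The adjacency matrix `A` of `Υ`. -/
def adjMat : Matrix (verts R) (verts R) ℝ := fun u v => (edgeCount R u v : ℝ)

/-- The matrix `D^{-1/2}`; its entry at a vertex of degree `0` is `0`. -/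
noncomputable def degInvSqrt : Matrix (verts R) (verts R) ℝ :=
  Matrix.diagonal fun v => (√(deg R v : ℝ))⁻¹

/-- The normalised Laplacian `I - D^{-1/2} A D^{-1/2}` of `Υ`. -/
noncomputable def laplacian : Matrix (verts R) (verts R) ℝ :=
  1 - degInvSqrt R * adjMat R * degInvSqrt R

theorem edgeCount_comm (u v : Word S) : edgeCount R u v = edgeCount R v u := by
  unfold edgeCount
  rw [add_comm]
  congr 2 <;> ext r <;> simp [and_comm]

theorem laplacian_isHermitian : (laplacian R).IsHermitian := by
  have hA : (adjMat R).transpose = adjMat R := by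
    ext u v
    simp [adjMat, edgeCount_comm R v u]
  have hD : (degInvSqrt R).transpose = degInvSqrt R := by
    simp [degInvSqrt]
  unfold Matrix.IsHermitian laplacian
  rw [Matrix.conjTranspose_eq_transpose_of_trivial]
  simp [Matrix.transpose_mul, hA, hD, Matrix.mul_assoc]

end Graph

/-- The second smallest eigenvalue, with multiplicity, of a real symmetric matrix
(`eigenvalues₀` lists the eigenvalues in decreasing order); `0` if the matrix has size below `2`. -/
noncomputable def secondSmallestEigenvalue {n : Type*} [Fintype n] [DecidableEq n]
    {M : Matrix n n ℝ} (hM : M.IsHermitian) : ℝ :=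
  if h : 2 ≤ Fintype.card n then hM.eigenvalues₀ ⟨Fintype.card n - 2, by omega⟩ else 0

/-- `λ₁(Υ)`, where the eigenvalues of the normalised Laplacian are `λ₀ ≤ λ₁ ≤ …`. -/
noncomputable def lambdaOne {S : Type*} [DecidableEq S] (R : Finset (Triple S)) : ℝ :=
  secondSmallestEigenvalue (laplacian_isHermitian R)

/-! ### The quotients and Property (T) -/

/-- The quotient `G / ⟨⟨xyz : (x, y, z) ∈ R⟩⟩` of `G = ⟨S | T⟩`. -/
abbrev RelatorQuotient {S : Type*} (T : Set (FreeGroup S)) (R : Finset (Triple S)) :=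
  PresentedGroup T ⧸ Subgroup.normalClosure
    {g : PresentedGroup T | ∃ r ∈ R, eval T r.concat = g}

/-- A unitary representation has almost-invariant vectors: for every finite set `F ⊆ Γ` and every
`ε > 0` there is a nonzero vector moved by less than `ε` times its norm by all elements of `F`.
For finitely generated `Γ` it is equivalent to test one finite generating set `F`. -/
def HasAlmostInvariantVectors {Γ H : Type*} [Group Γ] [NormedAddCommGroup H]
    [InnerProductSpace ℂ H] (π : Γ →* (H ≃ₗᵢ[ℂ] H)) : Prop :=
  ∀ F : Finset Γ, ∀ ε : ℝ, 0 < ε → ∃ u : H, u ≠ 0 ∧ ∀ s ∈ F, ‖π s u - u‖ < ε * ‖u‖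

/-- Property (T) for a discrete group, tested on complex Hilbert spaces in the universe `v`. -/
def HasPropertyT (Γ : Type u) [Group Γ] : Prop :=
  ∀ (H : Type v) [NormedAddCommGroup H] [InnerProductSpace ℂ H] [CompleteSpace H]
    (π : Γ →* (H ≃ₗᵢ[ℂ] H)), HasAlmostInvariantVectors π →
      ∃ u : H, u ≠ 0 ∧ ∀ g : Γ, π g u = u

end HypQuot

namespace HypQuot

/-! ### The second eigenvalue and vector-valued functions -/

section Spectral

variable {n : Type*} [Fintype n]
  {H : Type*} [NormedAddCommGroup H] [InnerProductSpace ℝ H]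

/-! Let `π` be a unitary representation of the quotient, regarded as a real orthogonal
representation, and put `b w = π w u - u`. For a triple `(x, y, z)` the relation `xyz = 1` gives
`z⁻¹ = xy`, so the difference of `b` along the edge `(x, z⁻¹)` has norm `‖b y‖`. The Poincaré
inequality of `Υ`, applied to `b` minus its degree-weighted mean, therefore bounds `λ₁` times the
variance of `b` by `∑ ‖b y‖²`, which is half of `∑ rep w * ‖b w‖²`. As `‖b w‖` depends only on the
group element, `rep` may be replaced by `deg` up to a factor close to `1`. When `λ₁ > 1/2` the
variance cannot absorb all of `∑ deg w * ‖b w‖²`, so the mean of `b` is bounded below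
(`mul_sum_deg_le`).

After the degrees are symmetrised under inversion, the mean is `-Δ u` for a self-adjoint averaging
operator `Δ`, and the bound reads `c ⟪Δ u, u⟫ ≤ ‖Δ u‖²`: a spectral gap. Hence a vector of small
displacement lies near the kernel of `Δ` (`exists_kernel_vector`), whose elements are fixed by every
vertex of `Υ` (`exists_near_fixed_by_verts`). The vertices contain all words of `L` of length `l /
3`, which generate a subgroup of finite index, and summing over its cosets produces an invariant
vector (`exists_invariant_of_finiteIndex`). -/

theorem norm_sum_smul_sq (b : n → ℝ) (x : n → H) :
    ‖∑ i, b i • x i‖ ^ 2 = ∑ i, ∑ j, b i * b j * inner ℝ (x i) (x j) := by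
  rw [← real_inner_self_eq_norm_sq, sum_inner]
  refine Finset.sum_congr rfl fun i _ => ?_
  rw [inner_sum]
  refine Finset.sum_congr rfl fun j _ => ?_
  rw [real_inner_smul_left, real_inner_smul_right]
  ring

/-- Scalar quadratic forms act on `H`-valued functions through the Gram matrix alone. This lets the
spectral decomposition of `M` be used without choosing a basis of `H`. -/
theorem sum_mul_norm_sum_smul_sq (a : n → ℝ) (b : n → n → ℝ) (x : n → H) :
    ∑ k, a k * ‖∑ i, b k i • x i‖ ^ 2 =
      ∑ i, ∑ j, (∑ k, a k * (b k i * b k j)) * inner ℝ (x i) (x j) := by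
  simp_rw [norm_sum_smul_sq, Finset.mul_sum]
  rw [Finset.sum_comm]
  refine Finset.sum_congr rfl fun i _ => ?_
  rw [Finset.sum_comm]
  refine Finset.sum_congr rfl fun j _ => ?_
  rw [Finset.sum_mul]
  exact Finset.sum_congr rfl fun k _ => by ring

variable [DecidableEq n] {M : Matrix n n ℝ}

theorem sum_eigenvectorBasis_mul (hM : M.IsHermitian) (i j : n) :
    ∑ k, hM.eigenvectorBasis k i * hM.eigenvectorBasis k j = if i = j then 1 else 0 := by
  have h : (hM.eigenvectorUnitary : Matrix n n ℝ) *
      star (hM.eigenvectorUnitary : Matrix n n ℝ) = 1 :=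
    Unitary.coe_mul_star_self _
  have h' := congrFun (congrFun h i) j
  simpa [Matrix.mul_apply, Matrix.star_apply, Matrix.one_apply] using h'

theorem sum_mul_eigenvectorBasis (hM : M.IsHermitian) (k i : n) :
    ∑ j, M i j * hM.eigenvectorBasis k j = hM.eigenvalues k * hM.eigenvectorBasis k i := by
  simpa [Matrix.mulVec, dotProduct] using congrFun (hM.mulVec_eigenvectorBasis k) i

theorem entry_eq_sum_eigenvectorBasis (hM : M.IsHermitian) (i j : n) :
    M i j = ∑ k, hM.eigenvalues k * (hM.eigenvectorBasis k i * hM.eigenvectorBasis k j) := by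
  calc M i j = ∑ l, M i l * ∑ k, hM.eigenvectorBasis k l * hM.eigenvectorBasis k j := by
        simp [sum_eigenvectorBasis_mul]
    _ = ∑ k, (∑ l, M i l * hM.eigenvectorBasis k l) * hM.eigenvectorBasis k j := by
        simp_rw [Finset.mul_sum, Finset.sum_mul]
        rw [Finset.sum_comm]
        simp_rw [mul_assoc]
    _ = _ := by simp_rw [sum_mul_eigenvectorBasis, mul_assoc]

theorem sum_entry_mul_inner (hM : M.IsHermitian) (x : n → H) :
    ∑ i, ∑ j, M i j * inner ℝ (x i) (x j) =
      ∑ k, hM.eigenvalues k * ‖∑ i, hM.eigenvectorBasis k i • x i‖ ^ 2 := by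
  rw [sum_mul_norm_sum_smul_sq]
  simp_rw [← entry_eq_sum_eigenvectorBasis]

theorem sum_norm_sq_eq (hM : M.IsHermitian) (x : n → H) :
    ∑ i, ‖x i‖ ^ 2 = ∑ k, ‖∑ i, hM.eigenvectorBasis k i • x i‖ ^ 2 := by
  have h := sum_mul_norm_sum_smul_sq (fun _ => 1) (fun k i => hM.eigenvectorBasis k i) x
  simpa [sum_eigenvectorBasis_mul] using h.symm

/-- If the second smallest eigenvalue is positive, then it bounds the quadratic form from below
on vector-valued functions orthogonal to a nonzero kernel vector. -/
theorem secondSmallestEigenvalue_mul_le (hM : M.IsHermitian)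
    (hpos : 0 < secondSmallestEigenvalue hM) {e : n → ℝ} (he : e ≠ 0)
    (hMe : ∀ i, ∑ j, M i j * e j = 0) (x : n → H) (hx : ∑ i, e i • x i = 0) :
    secondSmallestEigenvalue hM * ∑ i, ‖x i‖ ^ 2 ≤ ∑ i, ∑ j, M i j * inner ℝ (x i) (x j) := by
  -- In size below `2` the default value `0` contradicts positivity.
  have hcard : 2 ≤ Fintype.card n := by
    by_contra h
    simp [secondSmallestEigenvalue, h] at hpos
  set lam := secondSmallestEigenvalue hM with hlam
  have hlam' : lam = hM.eigenvalues₀ ⟨Fintype.card n - 2, by omega⟩ := by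
    rw [hlam, secondSmallestEigenvalue, dif_pos hcard]
  -- This is the reindexing by which `eigenvalues` is defined from `eigenvalues₀`. The order is
  -- decreasing, so `k₀` carries the smallest eigenvalue.
  let φ : Fin (Fintype.card n) ≃ n := Fintype.equivOfCardEq (Fintype.card_fin _)
  let k₀ : n := φ ⟨Fintype.card n - 1, by omega⟩
  have hev : ∀ k, k ≠ k₀ → lam ≤ hM.eigenvalues k := by
    intro k hk
    have hk' : φ.symm k ≠ ⟨Fintype.card n - 1, by omega⟩ := fun h =>
      hk (by simp [k₀, ← h])
    rw [hlam']
    refine hM.eigenvalues₀_antitone (Fin.le_def.2 ?_)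
    have h1 := (φ.symm k).2
    have h2 : (φ.symm k : ℕ) ≠ Fintype.card n - 1 := fun h => hk' (Fin.ext h)
    change (φ.symm k : ℕ) ≤ Fintype.card n - 2
    omega
  let c : n → ℝ := fun k => ∑ i, hM.eigenvectorBasis k i * e i
  -- The kernel vector `e` is orthogonal to eigenvectors of nonzero eigenvalue, so it is a multiple
  -- of the `k₀`-th one. Thus `hx` kills the `k₀`-component of `x`.
  have hc : ∀ k, k ≠ k₀ → c k = 0 := by
    intro k hk
    have h0 : hM.eigenvalues k * c k = 0 := by
      calc hM.eigenvalues k * c k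
          = ∑ i, (∑ j, M i j * hM.eigenvectorBasis k j) * e i := by
            simp_rw [sum_mul_eigenvectorBasis, c, Finset.mul_sum, mul_assoc]
        _ = ∑ j, hM.eigenvectorBasis k j * ∑ i, M j i * e i := by
            simp_rw [Finset.sum_mul, Finset.mul_sum]
            rw [Finset.sum_comm]
            refine Finset.sum_congr rfl fun j _ => Finset.sum_congr rfl fun i _ => ?_
            have : M i j = M j i := by simpa using hM.apply j i
            rw [this]; ring
        _ = 0 := by simp [hMe]
    rcases mul_eq_zero.1 h0 with h | h
    · exact absurd h (hpos.trans_le (hev k hk)).ne'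
    · exact h
  have he' : ∀ i, e i = c k₀ * hM.eigenvectorBasis k₀ i := by
    intro i
    calc e i = ∑ j, (∑ k, hM.eigenvectorBasis k i * hM.eigenvectorBasis k j) * e j := by
          simp [sum_eigenvectorBasis_mul]
      _ = ∑ k, c k * hM.eigenvectorBasis k i := by
          simp_rw [Finset.sum_mul, c]
          rw [Finset.sum_comm]
          refine Finset.sum_congr rfl fun k _ => ?_
          rw [Finset.sum_mul]
          exact Finset.sum_congr rfl fun j _ => by ring
      _ = _ := Finset.sum_eq_single _ (fun k _ hk => by rw [hc k hk, zero_mul]) (by simp)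
  have hc₀ : c k₀ ≠ 0 := fun h => he (funext fun i => by rw [he', h]; simp)
  have hx₀ : ∑ i, hM.eigenvectorBasis k₀ i • x i = 0 := by
    have : c k₀ • ∑ i, hM.eigenvectorBasis k₀ i • x i = 0 := by
      rw [← hx, Finset.smul_sum]
      exact Finset.sum_congr rfl fun i _ => by rw [he' i, smul_smul]
    exact (smul_eq_zero.1 this).resolve_left hc₀
  rw [sum_entry_mul_inner hM, sum_norm_sq_eq hM, Finset.mul_sum]
  refine Finset.sum_le_sum fun k _ => ?_
  by_cases hk : k = k₀
  · subst hk; simp [hx₀]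
  · exact mul_le_mul_of_nonneg_right (hev k hk) (sq_nonneg _)

end Spectral

/-! ### Bounded operators with a quadratic gap -/

/-- A positive symmetric operator `Δ` with `c ⟪Δ u, u⟫ ≤ ‖Δ u‖²` has a kernel vector at distance
at most a multiple of `⟪Δ u, u⟫^{1/2}` from any vector `u`. -/
theorem exists_kernel_vector {H : Type*} [NormedAddCommGroup H] [InnerProductSpace ℝ H]
    [CompleteSpace H] {c : ℝ} (hc : 0 < c) (Δ : H →L[ℝ] H)
    (hsymm : ∀ u v, inner ℝ (Δ u) v = inner ℝ u (Δ v))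
    (hpos : ∀ u, 0 ≤ inner ℝ (Δ u) u)
    (hupper : ∀ u, ‖Δ u‖ ^ 2 ≤ 2 * inner ℝ (Δ u) u)
    (hgap : ∀ u, c * inner ℝ (Δ u) u ≤ ‖Δ u‖ ^ 2) :
    ∃ C : ℝ, 0 ≤ C ∧ ∀ u, ∃ v, Δ v = 0 ∧ ‖u - v‖ ≤ C * √(inner ℝ (Δ u) u) := by
  -- Lowering the constant to at most `1` makes the ratio `r = 1 - c' / 2` nonnegative.
  obtain ⟨c', hc', hc1, hgap'⟩ : ∃ c' : ℝ, 0 < c' ∧ c' ≤ 1 ∧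
      ∀ u, c' * inner ℝ (Δ u) u ≤ ‖Δ u‖ ^ 2 :=
    ⟨min c 1, lt_min hc one_pos, min_le_right _ _, fun u =>
      (mul_le_mul_of_nonneg_right (min_le_left _ _) (hpos u)).trans (hgap u)⟩
  set r : ℝ := 1 - c' / 2 with hr
  have hr0 : 0 ≤ r := by rw [hr]; linarith
  have hr1 : r < 1 := by rw [hr]; linarith
  have hs1 : √r < 1 := by rw [← Real.sqrt_one]; exact Real.sqrt_lt_sqrt hr0 hr1
  -- The damped iteration `u ↦ u - Δ u / 2` contracts the energy `⟪Δ u, u⟫`: since `‖Δ‖ ≤ 2`, the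
  -- energy drops by at least `‖Δ u‖² / 2`. Its increments are then bounded by a geometric sequence
  -- of ratio `√r`, and the limit is the kernel vector.
  have hstep : ∀ u, inner ℝ (Δ (u - (1 / 2 : ℝ) • Δ u)) (u - (1 / 2 : ℝ) • Δ u) ≤
      r * inner ℝ (Δ u) u := by
    intro u
    have h1 : inner ℝ (Δ (u - (1 / 2 : ℝ) • Δ u)) (u - (1 / 2 : ℝ) • Δ u) =
        inner ℝ (Δ u) u - ‖Δ u‖ ^ 2 + 1 / 4 * inner ℝ (Δ (Δ u)) (Δ u) := by
      rw [map_sub, map_smul, inner_sub_left, inner_sub_right, inner_sub_right,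
        real_inner_smul_left, real_inner_smul_left, real_inner_smul_right, real_inner_smul_right,
        hsymm (Δ u) u, real_inner_self_eq_norm_sq]
      ring
    have h2 : inner ℝ (Δ (Δ u)) (Δ u) ≤ 2 * ‖Δ u‖ ^ 2 := by
      have hcs := real_inner_le_norm (Δ (Δ u)) (Δ u)
      have hu := hupper (Δ u)
      have h3 : ‖Δ (Δ u)‖ ≤ 2 * ‖Δ u‖ := by
        by_contra hlt
        push Not at hlt
        have h0 := norm_nonneg (Δ u)
        nlinarith
      nlinarith [norm_nonneg (Δ u)]
    rw [h1]
    have := hgap' u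
    rw [hr]
    linarith
  refine ⟨1 / (1 - √r), by have := sub_pos.2 hs1; positivity, fun u => ?_⟩
  let f : ℕ → H := fun n => (fun w => w - (1 / 2 : ℝ) • Δ w)^[n] u
  have hf : ∀ n, f (n + 1) = f n - (1 / 2 : ℝ) • Δ (f n) := fun n =>
    Function.iterate_succ_apply' _ _ _
  have hE : ∀ n, inner ℝ (Δ (f n)) (f n) ≤ r ^ n * inner ℝ (Δ u) u := by
    intro n
    induction n with
    | zero => simp [f]
    | succ n ih =>
      rw [hf, pow_succ']
      refine (hstep _).trans ?_
      rw [mul_assoc]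
      exact mul_le_mul_of_nonneg_left ih hr0
  have hΔ : ∀ n, ‖Δ (f n)‖ ≤ 2 * (√(inner ℝ (Δ u) u) * √r ^ n) := by
    intro n
    have h1 := (hupper (f n)).trans (mul_le_mul_of_nonneg_left (hE n) zero_le_two)
    refine abs_le_of_sq_le_sq' ?_ (by positivity) |>.2
    have h2 : (√(inner ℝ (Δ u) u) * √r ^ n) ^ 2 = r ^ n * inner ℝ (Δ u) u := by
      rw [mul_pow, Real.sq_sqrt (hpos u), ← pow_mul, mul_comm n 2, pow_mul, Real.sq_sqrt hr0,
        mul_comm]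
    rw [mul_pow, h2]
    have : 0 ≤ r ^ n * inner ℝ (Δ u) u := mul_nonneg (pow_nonneg hr0 n) (hpos u)
    linarith
  have hd : ∀ n, dist (f n) (f (n + 1)) ≤ √(inner ℝ (Δ u) u) * √r ^ n := by
    intro n
    rw [dist_eq_norm, hf, sub_sub_cancel, norm_smul]
    have := hΔ n
    norm_num
    linarith
  obtain ⟨v, hv⟩ := cauchySeq_tendsto_of_complete (cauchySeq_of_le_geometric _ _ hs1 hd)
  refine ⟨v, ?_, ?_⟩
  · have h1 : Tendsto (fun n => Δ (f n)) atTop (𝓝 (Δ v)) := (Δ.continuous.tendsto v).comp hv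
    have h2 : Tendsto (fun n => Δ (f n)) atTop (𝓝 0) := by
      refine squeeze_zero_norm hΔ ?_
      have := (tendsto_pow_atTop_nhds_zero_of_lt_one (Real.sqrt_nonneg r) hs1).const_mul
        (√(inner ℝ (Δ u) u)) |>.const_mul 2
      simpa using this
    exact tendsto_nhds_unique h1 h2
  · have := dist_le_of_le_geometric_of_tendsto₀ _ _ hs1 hd hv
    rw [dist_eq_norm] at this
    calc ‖u - v‖ ≤ √(inner ℝ (Δ u) u) / (1 - √r) := this
      _ = _ := by ring

/-! ### Averaging operators of representations, and finite-index subgroups. -/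

theorem rep_mul_apply {𝕜 Γ H : Type*} [RCLike 𝕜] [Group Γ] [NormedAddCommGroup H]
    [InnerProductSpace 𝕜 H] (π : Γ →* (H ≃ₗᵢ[𝕜] H)) (g h : Γ) (u : H) :
    π (g * h) u = π g (π h u) := by
  rw [map_mul]
  rfl

theorem rep_apply_inv_apply {𝕜 Γ H : Type*} [RCLike 𝕜] [Group Γ] [NormedAddCommGroup H]
    [InnerProductSpace 𝕜 H] (π : Γ →* (H ≃ₗᵢ[𝕜] H)) (g : Γ) (u : H) :
    π g (π g⁻¹ u) = u := by
  rw [← rep_mul_apply, mul_inv_cancel, map_one]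
  rfl

section Averaging

variable {ι Γ H : Type*} [Group Γ] [NormedAddCommGroup H] [InnerProductSpace ℝ H]

theorem norm_sum_smul_sq_le (s : Finset ι) {a : ι → ℝ} (ha : ∀ i ∈ s, 0 ≤ a i) (x : ι → H) :
    ‖∑ i ∈ s, a i • x i‖ ^ 2 ≤ (∑ i ∈ s, a i) * ∑ i ∈ s, a i * ‖x i‖ ^ 2 := by
  have h1 : ‖∑ i ∈ s, a i • x i‖ ≤ ∑ i ∈ s, a i * ‖x i‖ := by
    refine (norm_sum_le _ _).trans (Finset.sum_le_sum fun i hi => ?_)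
    rw [norm_smul, Real.norm_of_nonneg (ha i hi)]
  refine (pow_le_pow_left₀ (norm_nonneg _) h1 2).trans ?_
  refine Finset.sum_sq_le_sum_mul_sum_of_sq_le_mul s ha
    (fun i hi => mul_nonneg (ha i hi) (sq_nonneg _)) fun i _ => le_of_eq (by ring)

theorem norm_apply_inv_sub (π : Γ →* (H ≃ₗᵢ[ℝ] H)) (g : Γ) (u : H) :
    ‖π g⁻¹ u - u‖ = ‖π g u - u‖ := by
  have h : π g (π g⁻¹ u - u) = u - π g u := by
    rw [map_sub, rep_apply_inv_apply]
  rw [← (π g).norm_map, h, norm_sub_rev]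

theorem inner_apply_left (π : Γ →* (H ≃ₗᵢ[ℝ] H)) (g : Γ) (u v : H) :
    inner ℝ (π g u) v = inner ℝ u (π g⁻¹ v) := by
  rw [← (π g).inner_map_map u (π g⁻¹ v), rep_apply_inv_apply]

theorem inner_sub_apply_self (π : Γ →* (H ≃ₗᵢ[ℝ] H)) (g : Γ) (u : H) :
    inner ℝ (u - π g u) u = 1 / 2 * ‖π g u - u‖ ^ 2 := by
  rw [norm_sub_sq_real, (π g).norm_map, inner_sub_left, real_inner_self_eq_norm_sq]
  ring

/-- A spectral gap for a symmetric random walk gives invariant vectors near any vector with small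
displacement. -/
theorem exists_near_fixed_vector [CompleteSpace H] (π : Γ →* (H ≃ₗᵢ[ℝ] H)) (s : Finset ι)
    (g : ι → Γ) (τ : ι → ι) (hτ : ∀ i, τ (τ i) = i) (hτs : ∀ i ∈ s, τ i ∈ s)
    (hg : ∀ i, g (τ i) = (g i)⁻¹) (a : ι → ℝ) (ha : ∀ i ∈ s, 0 ≤ a i)
    (haτ : ∀ i ∈ s, a (τ i) = a i) (ha1 : ∑ i ∈ s, a i = 1) {c : ℝ} (hc : 0 < c)
    (hgap : ∀ u, c * ∑ i ∈ s, a i * ‖π (g i) u - u‖ ^ 2 ≤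
      ‖∑ i ∈ s, a i • (π (g i) u - u)‖ ^ 2) :
    ∃ C : ℝ, 0 ≤ C ∧ ∀ u, ∃ v, (∀ i ∈ s, 0 < a i → π (g i) v = v) ∧
      ‖u - v‖ ≤ C * √(∑ i ∈ s, a i * ‖π (g i) u - u‖ ^ 2) := by
  let Δ : H →L[ℝ] H := ∑ i ∈ s, a i • (ContinuousLinearMap.id ℝ H -
    ((π (g i)).toContinuousLinearEquiv : H →L[ℝ] H))
  have hΔ : ∀ u, Δ u = ∑ i ∈ s, a i • (u - π (g i) u) := fun u => by
    simp [Δ]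
  have hnorm : ∀ u, ‖Δ u‖ = ‖∑ i ∈ s, a i • (π (g i) u - u)‖ := fun u => by
    rw [hΔ, ← norm_neg, ← Finset.sum_neg_distrib]
    simp_rw [← smul_neg, neg_sub]
  have hE : ∀ u, inner ℝ (Δ u) u = 1 / 2 * ∑ i ∈ s, a i * ‖π (g i) u - u‖ ^ 2 := fun u => by
    rw [hΔ, sum_inner, Finset.mul_sum]
    refine Finset.sum_congr rfl fun i _ => ?_
    rw [real_inner_smul_left, inner_sub_apply_self]
    ring
  have hEnn : ∀ u, 0 ≤ ∑ i ∈ s, a i * ‖π (g i) u - u‖ ^ 2 := fun u =>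
    Finset.sum_nonneg fun i hi => mul_nonneg (ha i hi) (sq_nonneg _)
  have hsymm : ∀ u v, inner ℝ (Δ u) v = inner ℝ u (Δ v) := by
    intro u v
    rw [hΔ, hΔ, sum_inner, inner_sum]
    -- The adjoint of `π (g i)` is `π (g (τ i))`, and the weights are `τ`-invariant.
    refine Finset.sum_nbij' τ τ hτs hτs (fun i _ => hτ i) (fun i _ => hτ i) fun i hi => ?_
    rw [real_inner_smul_left, real_inner_smul_right, inner_sub_left, inner_sub_right,
      inner_apply_left, hg, haτ i hi]
  -- The factor `2` compensates the `1 / 2` in `hE`.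
  obtain ⟨C, hC, h⟩ := exists_kernel_vector (c := 2 * c) (by positivity) Δ hsymm
    (fun u => by rw [hE]; exact mul_nonneg (by norm_num) (hEnn u))
    (fun u => by
      rw [hE, hnorm]
      have := norm_sum_smul_sq_le s ha fun i => π (g i) u - u
      rw [ha1] at this
      linarith)
    (fun u => by rw [hE, hnorm]; have := hgap u; linarith)
  refine ⟨C, hC, fun u => ?_⟩
  obtain ⟨v, hv, huv⟩ := h u
  refine ⟨v, fun i hi hai => ?_, huv.trans (mul_le_mul_of_nonneg_left ?_ hC)⟩
  · have h0 : ∑ i ∈ s, a i * ‖π (g i) v - v‖ ^ 2 = 0 := by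
      have := hE v
      rw [hv, inner_zero_left] at this
      linarith
    have h1 := (Finset.sum_eq_zero_iff_of_nonneg
      fun i hi => mul_nonneg (ha i hi) (sq_nonneg _)).1 h0 i hi
    have h2 : ‖π (g i) v - v‖ = 0 := by simpa [hai.ne'] using h1
    exact sub_eq_zero.1 (norm_eq_zero.1 h2)
  · rw [hE]
    exact Real.sqrt_le_sqrt (by linarith [hEnn u])

end Averaging

/-- If vectors with small displacement are close to vectors fixed by a finite-index subgroup, then
almost invariant vectors yield nonzero invariant vectors. -/
theorem exists_invariant_of_finiteIndex {Γ H : Type*} [Group Γ] [NormedAddCommGroup H]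
    [InnerProductSpace ℂ H] (π : Γ →* (H ≃ₗᵢ[ℂ] H)) (hπ : HasAlmostInvariantVectors π)
    (K : Subgroup Γ) [K.FiniteIndex] (F : Finset Γ) {C : ℝ} (hC : 0 ≤ C)
    (hK : ∀ (u : H) (ε : ℝ), (∀ s ∈ F, ‖π s u - u‖ ≤ ε) →
      ∃ v, (∀ k ∈ K, π k v = v) ∧ ‖u - v‖ ≤ C * ε) :
    ∃ u : H, u ≠ 0 ∧ ∀ g : Γ, π g u = u := by
  classical
  let _ : Fintype (Γ ⧸ K) := Fintype.ofFinite _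
  -- Coset representatives are included so that each translate `π q.out v` stays within `‖u‖ / 4` of
  -- `u`. Their sum then cannot vanish.
  let F' : Finset Γ := F ∪ Finset.univ.image fun q : Γ ⧸ K => q.out
  obtain ⟨u, hu0, hu⟩ := hπ F' (1 / (4 * C + 4)) (by positivity)
  set ε := 1 / (4 * C + 4) * ‖u‖ with hε
  have hu' : 0 < ‖u‖ := norm_pos_iff.2 hu0
  obtain ⟨v, hvK, huv⟩ := hK u ε fun s hs => (hu s (Finset.mem_union_left _ hs)).le
  have hsmall : C * ε + ε = ‖u‖ / 4 := by
    rw [hε]; field_simp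
  have hout : ∀ q : Γ ⧸ K, ‖π q.out v - u‖ ≤ ‖u‖ / 4 := by
    intro q
    have h1 : ‖π q.out u - u‖ ≤ ε :=
      (hu _ (Finset.mem_union_right _ (Finset.mem_image_of_mem _ (Finset.mem_univ q)))).le
    calc ‖π q.out v - u‖ = ‖π q.out (v - u) + (π q.out u - u)‖ := by
          rw [map_sub]; congr 1; abel
      _ ≤ ‖π q.out (v - u)‖ + ‖π q.out u - u‖ := norm_add_le _ _
      _ = ‖u - v‖ + ‖π q.out u - u‖ := by rw [LinearIsometryEquiv.norm_map, norm_sub_rev]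
      _ ≤ ‖u‖ / 4 := by linarith
  have hmk : ∀ g : Γ, π g v = π (QuotientGroup.mk g : Γ ⧸ K).out v := by
    intro g
    obtain ⟨k, hk⟩ := QuotientGroup.mk_out_eq_mul K g
    rw [hk, rep_mul_apply, hvK k k.2]
  refine ⟨∑ q : Γ ⧸ K, π q.out v, ?_, fun g => ?_⟩
  · intro h0
    have hcard : (0 : ℝ) < Fintype.card (Γ ⧸ K) := by exact_mod_cast Fintype.card_pos
    have h1 : ‖∑ q : Γ ⧸ K, (π q.out v - u)‖ ≤ Fintype.card (Γ ⧸ K) * (‖u‖ / 4) := by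
      refine (norm_sum_le _ _).trans ((Finset.sum_le_sum fun q _ => hout q).trans ?_)
      simp
    rw [Finset.sum_sub_distrib, h0, zero_sub, norm_neg, Finset.sum_const, Finset.card_univ,
      ← Nat.cast_smul_eq_nsmul ℝ, norm_smul, Real.norm_natCast] at h1
    nlinarith
  · rw [map_sum]
    refine Fintype.sum_equiv (MulAction.toPerm g) _ _ fun q => ?_
    rw [← rep_mul_apply, hmk]
    congr 3
    change QuotientGroup.mk (g • q.out) = g • q
    rw [← MulAction.Quotient.smul_coe, QuotientGroup.out_eq']

/-! ### Sums over the graph `Υ` and its Poincaré inequality. -/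

section GraphSums

variable {S : Type*}

theorem eval_append (T : Set (FreeGroup S)) (w w' : Word S) :
    eval T (w ++ w') = eval T w * eval T w' := by
  simp only [eval, ← map_mul, FreeGroup.mul_mk]

theorem eval_invRev (T : Set (FreeGroup S)) (w : Word S) :
    eval T (FreeGroup.invRev w) = (eval T w)⁻¹ := by
  simp only [eval, ← map_inv, FreeGroup.inv_mk]

variable [DecidableEq S] {R : Finset (Triple S)}

theorem mem_verts_of_mem_words {w : Word S} (h : w ∈ words R) : w ∈ verts R :=
  Finset.mem_union_left _ h

theorem invRev_mem_verts {w : Word S} (h : w ∈ verts R) : FreeGroup.invRev w ∈ verts R := by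
  rcases Finset.mem_union.1 h with h | h
  · exact Finset.mem_union_right _ (Finset.mem_image_of_mem _ h)
  · obtain ⟨w', hw', rfl⟩ := Finset.mem_image.1 h
    rw [FreeGroup.invRev_invRev]
    exact mem_verts_of_mem_words hw'

theorem fst_mem_verts {r : Triple S} (hr : r ∈ R) : r.1 ∈ verts R :=
  mem_verts_of_mem_words (Finset.mem_biUnion.2 ⟨r, hr, by simp⟩)

theorem snd_mem_verts {r : Triple S} (hr : r ∈ R) : r.2.1 ∈ verts R :=
  mem_verts_of_mem_words (Finset.mem_biUnion.2 ⟨r, hr, by simp⟩)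

theorem thd_mem_verts {r : Triple S} (hr : r ∈ R) : r.2.2 ∈ verts R :=
  mem_verts_of_mem_words (Finset.mem_biUnion.2 ⟨r, hr, by simp⟩)

variable (R)

theorem sum_card_filter_mul {α β : Type*} [DecidableEq β] (s : Finset α) (t : Finset β)
    (p : α → β) (hp : ∀ a ∈ s, p a ∈ t) (F : β → ℝ) :
    ∑ b ∈ t, ((s.filter fun a => p a = b).card : ℝ) * F b = ∑ a ∈ s, F (p a) := by
  rw [← Finset.sum_fiberwise_of_maps_to hp]
  refine Finset.sum_congr rfl fun b _ => ?_
  rw [Finset.sum_congr rfl fun a ha => by rw [(Finset.mem_filter.1 ha).2], Finset.sum_const,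
    nsmul_eq_mul]

theorem sum_edgeCount_mul (F : Word S → Word S → ℝ) :
    ∑ u ∈ verts R, ∑ v ∈ verts R, (edgeCount R u v : ℝ) * F u v =
      ∑ r ∈ R, (F r.1 (FreeGroup.invRev r.2.2) + F (FreeGroup.invRev r.2.2) r.1) := by
  have h1 := sum_card_filter_mul R (verts R ×ˢ verts R)
    (fun r => (r.1, FreeGroup.invRev r.2.2))
    (fun r hr => Finset.mem_product.2 ⟨fst_mem_verts hr, invRev_mem_verts (thd_mem_verts hr)⟩)
    fun p => F p.1 p.2
  have h2 := sum_card_filter_mul R (verts R ×ˢ verts R)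
    (fun r => (FreeGroup.invRev r.2.2, r.1))
    (fun r hr => Finset.mem_product.2 ⟨invRev_mem_verts (thd_mem_verts hr), fst_mem_verts hr⟩)
    fun p => F p.1 p.2
  rw [Finset.sum_add_distrib, ← h1, ← h2, ← Finset.sum_add_distrib, Finset.sum_product]
  refine Finset.sum_congr rfl fun u _ => Finset.sum_congr rfl fun v _ => ?_
  simp only [edgeCount, Prod.mk.injEq]
  push_cast
  ring

theorem sum_deg_mul (F : Word S → ℝ) :
    ∑ w ∈ verts R, (deg R w : ℝ) * F w = ∑ r ∈ R, (F r.1 + F (FreeGroup.invRev r.2.2)) := by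
  rw [← sum_edgeCount_mul R fun u _ => F u]
  simp [deg, Finset.sum_mul]

theorem sum_rep_mul (F : Word S → ℝ) :
    ∑ w ∈ verts R, (rep R w : ℝ) * F w = ∑ r ∈ R, (F r.2.1 + F (FreeGroup.invRev r.2.1)) := by
  have h1 := sum_card_filter_mul R (verts R) (fun r => r.2.1) (fun r hr => snd_mem_verts hr) F
  have h2 := sum_card_filter_mul R (verts R) (fun r => FreeGroup.invRev r.2.1)
    (fun r hr => invRev_mem_verts (snd_mem_verts hr)) F
  rw [Finset.sum_add_distrib, ← h1, ← h2, ← Finset.sum_add_distrib]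
  refine Finset.sum_congr rfl fun w _ => ?_
  simp only [rep, ← FreeGroup.invRev_involutive.eq_iff (y := w)]
  push_cast
  rw [add_mul]

variable {R}

theorem edgeCount_eq_zero {w w' : Word S} (h : deg R w = 0) (hw' : w' ∈ verts R) :
    edgeCount R w w' = 0 :=
  Finset.sum_eq_zero_iff.1 h w' hw'

/-- The convention `0⁻¹ = 0` is harmless: a vertex of degree `0` has no edges to cancel. -/
theorem sqrt_deg_mul_edgeCount {w w' : Word S} (hw' : w' ∈ verts R) :
    √(deg R w : ℝ) * ((√(deg R w : ℝ))⁻¹ * edgeCount R w w') = edgeCount R w w' := by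
  by_cases h : deg R w = 0
  · simp [edgeCount_eq_zero h hw']
  · have : √(deg R w : ℝ) ≠ 0 := by positivity
    rw [mul_inv_cancel_left₀ this]

theorem laplacian_apply (i j : verts R) : laplacian R i j = (if i = j then 1 else 0) -
    (√(deg R i : ℝ))⁻¹ * edgeCount R i j * (√(deg R j : ℝ))⁻¹ := by
  simp [laplacian, degInvSqrt, adjMat, Matrix.one_apply]

/-- The Poincaré inequality of `Υ` for vector-valued functions of mean zero. -/
theorem lambdaOne_mul_le {H : Type*} [NormedAddCommGroup H] [InnerProductSpace ℝ H]
    (hpos : 0 < lambdaOne R) (f : Word S → H) (hf : ∑ w ∈ verts R, (deg R w : ℝ) • f w = 0) :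
    lambdaOne R * ∑ w ∈ verts R, (deg R w : ℝ) * ‖f w‖ ^ 2 ≤
      ∑ r ∈ R, ‖f r.1 - f (FreeGroup.invRev r.2.2)‖ ^ 2 := by
  -- The vector `√deg` lies in the kernel of the normalised Laplacian, and the substitution `x =
  -- √deg • f` turns its quadratic form into the edge sum.
  let e : verts R → ℝ := fun i => √(deg R i : ℝ)
  have hsq : ∀ w : Word S, √(deg R w : ℝ) * √(deg R w : ℝ) = deg R w := fun w =>
    Real.mul_self_sqrt (Nat.cast_nonneg _)
  by_cases he : e = 0
  · have h0 : ∑ w ∈ verts R, (deg R w : ℝ) * ‖f w‖ ^ 2 = 0 := by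
      refine Finset.sum_eq_zero fun w hw => ?_
      have : √(deg R w : ℝ) = 0 := congrFun he ⟨w, hw⟩
      rw [← hsq w, this]
      ring
    rw [h0, mul_zero]
    positivity
  have hLe : ∀ i, ∑ j, laplacian R i j * e j = 0 := by
    intro i
    have h1 : ∀ j : verts R, laplacian R i j * e j =
        (if i = j then e j else 0) - (√(deg R i : ℝ))⁻¹ * edgeCount R i j := by
      intro j
      have h2 := sqrt_deg_mul_edgeCount (w := (j : Word S)) i.2
      rw [edgeCount_comm R j i] at h2
      rw [laplacian_apply, sub_mul, ite_mul, one_mul, zero_mul]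
      congr 1
      calc _ = (√(deg R i : ℝ))⁻¹ * (√(deg R j : ℝ) * ((√(deg R j : ℝ))⁻¹ * edgeCount R i j)) := by
            simp only [e]; ring
        _ = _ := by rw [h2]
    have h3 : ∑ j : verts R, (edgeCount R i j : ℝ) = √(deg R i : ℝ) * √(deg R i : ℝ) := by
      rw [hsq, deg, Nat.cast_sum, ← Finset.sum_coe_sort (verts R)]
    rw [Finset.sum_congr rfl fun j _ => h1 j, Finset.sum_sub_distrib, ← Finset.mul_sum, h3,
      Finset.sum_ite_eq, if_pos (Finset.mem_univ _)]
    by_cases h : √(deg R i : ℝ) = 0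
    · simp [e, h]
    · rw [inv_mul_cancel_left₀ h, sub_self]
  have hx : ∑ i, e i • (e i • f i) = 0 := by
    simp_rw [smul_smul, e, hsq]
    rw [← hf, ← Finset.sum_coe_sort (verts R)]
  have key := secondSmallestEigenvalue_mul_le (laplacian_isHermitian R) hpos he hLe
    (fun i => e i • f i) hx
  have hl : ∑ i : verts R, ‖e i • f i‖ ^ 2 = ∑ w ∈ verts R, (deg R w : ℝ) * ‖f w‖ ^ 2 := by
    rw [← Finset.sum_coe_sort (verts R)]
    refine Finset.sum_congr rfl fun i _ => ?_
    rw [norm_smul, Real.norm_of_nonneg (Real.sqrt_nonneg _), mul_pow,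
      Real.sq_sqrt (Nat.cast_nonneg _)]
  rw [hl] at key
  refine key.trans_eq ?_
  have h4 : ∀ i j : verts R, laplacian R i j * inner ℝ (e i • f i) (e j • f j) =
      (if i = j then (deg R j : ℝ) * ‖f j‖ ^ 2 else 0) -
        edgeCount R i j * inner ℝ (f i) (f j) := by
    intro i j
    have h2 := sqrt_deg_mul_edgeCount (w := (j : Word S)) i.2
    rw [edgeCount_comm R j i] at h2
    have h3 := sqrt_deg_mul_edgeCount (w := (i : Word S)) j.2
    rw [laplacian_apply, sub_mul]
    congr 1
    · split_ifs with h
      · subst h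
        rw [one_mul, real_inner_smul_left, real_inner_smul_right, real_inner_self_eq_norm_sq,
          ← mul_assoc, hsq]
      · rw [zero_mul]
    · rw [real_inner_smul_left, real_inner_smul_right]
      calc _ = √(deg R i : ℝ) * ((√(deg R i : ℝ))⁻¹ *
            (√(deg R j : ℝ) * ((√(deg R j : ℝ))⁻¹ * edgeCount R i j))) *
            inner ℝ (f i) (f j) := by simp only [e]; ring
        _ = _ := by rw [h2, h3]
  calc _ = ∑ w ∈ verts R, (deg R w : ℝ) * ‖f w‖ ^ 2 -
        ∑ u ∈ verts R, ∑ v ∈ verts R, (edgeCount R u v : ℝ) * inner ℝ (f u) (f v) := by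
        simp_rw [h4, Finset.sum_sub_distrib, Finset.sum_ite_eq, Finset.mem_univ, if_true,
          ← Finset.sum_coe_sort (verts R)]
    _ = _ := by
        rw [sum_edgeCount_mul R fun u v => inner ℝ (f u) (f v), sum_deg_mul,
          ← Finset.sum_sub_distrib]
        refine Finset.sum_congr rfl fun r _ => ?_
        rw [norm_sub_sq_real, real_inner_comm (f r.1)]
        ring

end GraphSums

/-! ### The spectral inequality for representations that kill the relators. -/

section Criterion

variable {S : Type*} [DecidableEq S] {R : Finset (Triple S)} {T : Set (FreeGroup S)}

theorem sum_deg_invRev_mul (F : Word S → ℝ) :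
    ∑ w ∈ verts R, (deg R (FreeGroup.invRev w) : ℝ) * F w =
      ∑ w ∈ verts R, (deg R w : ℝ) * F (FreeGroup.invRev w) :=
  Finset.sum_nbij' FreeGroup.invRev FreeGroup.invRev (fun _ => invRev_mem_verts)
    (fun _ => invRev_mem_verts) (fun _ _ => FreeGroup.invRev_invRev)
    (fun _ _ => FreeGroup.invRev_invRev) fun w _ => by rw [FreeGroup.invRev_invRev]

-- The degree hypotheses concern group elements, not words, so sums over vertices have to be
-- regrouped along the fibres of `eval T`.
open Classical in
theorem sum_smul_eval {E : Type*} [AddCommGroup E] [Module ℝ E] (a : Word S → ℝ)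
    (F : PresentedGroup T → E) :
    ∑ w ∈ verts R, a w • F (eval T w) =
      ∑ g ∈ (verts R).image (eval T),
        (∑ w ∈ (verts R).filter (fun w => eval T w = g), a w) • F g := by
  rw [← Finset.sum_fiberwise_of_maps_to (g := eval T) (t := (verts R).image (eval T))
    fun w hw => Finset.mem_image_of_mem _ hw]
  refine Finset.sum_congr rfl fun g _ => ?_
  rw [Finset.sum_smul]
  exact Finset.sum_congr rfl fun w hw => by rw [(Finset.mem_filter.1 hw).2]

theorem degElt_inv (g : PresentedGroup T) [DecidablePred fun w : Word S => eval T w = g] :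
    (degElt R T g⁻¹ : ℝ) =
      ∑ w ∈ (verts R).filter (fun w => eval T w = g), (deg R (FreeGroup.invRev w) : ℝ) := by
  classical
  rw [degElt, Nat.cast_sum]
  refine Finset.sum_nbij' FreeGroup.invRev FreeGroup.invRev ?_ ?_
    (fun _ _ => FreeGroup.invRev_invRev) (fun _ _ => FreeGroup.invRev_invRev)
    fun w _ => by rw [FreeGroup.invRev_invRev]
  · intro w hw
    rw [Finset.mem_filter] at hw ⊢
    exact ⟨invRev_mem_verts hw.1, by rw [eval_invRev, hw.2, inv_inv]⟩
  · intro w hw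
    rw [Finset.mem_filter] at hw ⊢
    exact ⟨invRev_mem_verts hw.1, by rw [eval_invRev, hw.2]⟩

theorem exists_triple_of_mem_verts {w : Word S} (hw : w ∈ verts R) : ∃ r ∈ R,
    (w = r.1 ∨ w = r.2.1 ∨ w = r.2.2) ∨ (FreeGroup.invRev w = r.1 ∨ FreeGroup.invRev w = r.2.1 ∨
      FreeGroup.invRev w = r.2.2) := by
  have key : ∀ {w : Word S}, w ∈ words R → ∃ r ∈ R, w = r.1 ∨ w = r.2.1 ∨ w = r.2.2 := by
    intro w hw
    obtain ⟨r, hr, h⟩ := Finset.mem_biUnion.1 hw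
    exact ⟨r, hr, by simpa using h⟩
  rcases Finset.mem_union.1 hw with h | h
  · obtain ⟨r, hr, h⟩ := key h
    exact ⟨r, hr, Or.inl h⟩
  · obtain ⟨w', hw', rfl⟩ := Finset.mem_image.1 h
    obtain ⟨r, hr, h⟩ := key hw'
    exact ⟨r, hr, Or.inr (by simpa only [FreeGroup.invRev_invRev] using h)⟩

/-- Positivity of `λ₁` rules out the default value, so vertices exist. They come from triples, and
the total degree is twice the number of triples. -/
theorem sum_deg_pos (hpos : 0 < lambdaOne R) : 0 < ∑ w ∈ verts R, (deg R w : ℝ) := by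
  have hcard : 2 ≤ Fintype.card (verts R) := by
    by_contra h
    rw [lambdaOne, secondSmallestEigenvalue, dif_neg h] at hpos
    exact hpos.false
  have hne : (verts R).Nonempty := by
    rw [Fintype.card_coe] at hcard
    exact Finset.card_pos.1 (by omega)
  obtain ⟨w, hw⟩ := hne
  obtain ⟨r, hr, -⟩ := exists_triple_of_mem_verts hw
  have h := sum_deg_mul R fun _ => 1
  simp only [mul_one, Finset.sum_const, nsmul_eq_mul] at h
  rw [h]
  have : (0 : ℝ) < R.card := by exact_mod_cast Finset.card_pos.2 ⟨r, hr⟩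
  positivity

theorem deg_fst_pos {r : Triple S} (hr : r ∈ R) : 0 < deg R r.1 := by
  refine Nat.pos_of_ne_zero fun h => ?_
  have h1 := edgeCount_eq_zero h (invRev_mem_verts (thd_mem_verts hr))
  have h2 := Finset.card_eq_zero.1 (Nat.add_eq_zero_iff.1 h1).1
  exact Finset.notMem_empty r (h2 ▸ Finset.mem_filter.2 ⟨hr, rfl, rfl⟩)

theorem deg_invRev_thd_pos {r : Triple S} (hr : r ∈ R) :
    0 < deg R (FreeGroup.invRev r.2.2) := by
  refine Nat.pos_of_ne_zero fun h => ?_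
  have h1 := edgeCount_eq_zero h (fst_mem_verts hr)
  have h2 := Finset.card_eq_zero.1 (Nat.add_eq_zero_iff.1 h1).2
  exact Finset.notMem_empty r (h2 ▸ Finset.mem_filter.2 ⟨hr, rfl, rfl⟩)

variable {H : Type*} [NormedAddCommGroup H] [InnerProductSpace ℝ H]

theorem sum_mul_norm_sub_mean_sq {ι : Type*} (s : Finset ι) (d : ι → ℝ) (hd : ∑ i ∈ s, d i ≠ 0)
    (b : ι → H) :
    ∑ i ∈ s, d i * ‖b i - (∑ i ∈ s, d i)⁻¹ • ∑ i ∈ s, d i • b i‖ ^ 2 =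
      ∑ i ∈ s, d i * ‖b i‖ ^ 2 - ‖∑ i ∈ s, d i • b i‖ ^ 2 / ∑ i ∈ s, d i := by
  set D := ∑ i ∈ s, d i with hD
  set B := ∑ i ∈ s, d i • b i with hB
  have h1 : ∀ i ∈ s, d i * ‖b i - D⁻¹ • B‖ ^ 2 =
      d i * ‖b i‖ ^ 2 - 2 * D⁻¹ * inner ℝ (d i • b i) B + d i * (D⁻¹ ^ 2 * ‖B‖ ^ 2) := by
    intro i _
    rw [norm_sub_sq_real, real_inner_smul_right, real_inner_smul_left, norm_smul, mul_pow,
      Real.norm_eq_abs, sq_abs]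
    ring
  rw [Finset.sum_congr rfl h1, Finset.sum_add_distrib, Finset.sum_sub_distrib, ← Finset.mul_sum,
    ← sum_inner, ← Finset.sum_mul, ← hB, ← hD, real_inner_self_eq_norm_sq]
  field_simp
  ring

/-- The spectral inequality for a representation that kills the relators. -/
theorem mul_sum_deg_le {ε : ℝ} (hε0 : 0 < ε) (hε1 : ε < 1)
    (hpos : 0 < lambdaOne R)
    (hdeg : ∀ g : PresentedGroup T, (∃ w ∈ verts R, eval T w = g) →
        |(degElt R T g : ℝ) - degElt R T g⁻¹| ≤ ε * degElt R T g⁻¹ ∧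
        |(degElt R T g : ℝ) - repElt R T g| ≤ ε * repElt R T g)
    (π : PresentedGroup T →* (H ≃ₗᵢ[ℝ] H)) (hπ : ∀ r ∈ R, π (eval T r.concat) = 1) (u : H) :
    (lambdaOne R * (1 - ε ^ 2 / 2) - (2 * (1 - ε))⁻¹) * (∑ w ∈ verts R, (deg R w : ℝ)) *
        ∑ w ∈ verts R, (deg R w : ℝ) * ‖π (eval T w) u - u‖ ^ 2 ≤
      2 * lambdaOne R * ‖∑ w ∈ verts R, (((deg R w : ℝ) + deg R (FreeGroup.invRev w)) / 2) •
        (π (eval T w) u - u)‖ ^ 2 := by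
  classical
  set b : Word S → H := fun w => π (eval T w) u - u with hb
  have hbinv : ∀ w, ‖b (FreeGroup.invRev w)‖ = ‖b w‖ := fun w => by
    simp only [hb, eval_invRev, norm_apply_inv_sub]
  set D := ∑ w ∈ verts R, (deg R w : ℝ) with hD
  set Q := ∑ w ∈ verts R, (deg R w : ℝ) * ‖b w‖ ^ 2 with hQ
  set B := ∑ w ∈ verts R, (deg R w : ℝ) • b w with hB
  set B' := ∑ w ∈ verts R, (((deg R w : ℝ) + deg R (FreeGroup.invRev w)) / 2) • b w with hB'
  have hDpos : 0 < D := sum_deg_pos hpos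
  -- Subtracting the mean does not change differences along edges, and by the relator each such
  -- difference has norm `‖b r.2.1‖`.
  have hpoinc : lambdaOne R * (Q - ‖B‖ ^ 2 / D) ≤ ∑ r ∈ R, ‖b r.2.1‖ ^ 2 := by
    have h := lambdaOne_mul_le hpos (fun w => b w - D⁻¹ • B) (by
      simp_rw [smul_sub, Finset.sum_sub_distrib, ← Finset.sum_smul, ← hB, ← hD, smul_smul,
        mul_inv_cancel₀ hDpos.ne', one_smul, sub_self])
    rw [sum_mul_norm_sub_mean_sq _ _ hDpos.ne'] at h
    refine h.trans (Finset.sum_le_sum fun r hr => le_of_eq ?_)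
    have h2 : π (eval T (FreeGroup.invRev r.2.2)) u = π (eval T r.1) (π (eval T r.2.1) u) := by
      have h3 : eval T r.concat * eval T (FreeGroup.invRev r.2.2) = eval T r.1 * eval T r.2.1 := by
        rw [Triple.concat, eval_append, eval_append, eval_invRev, mul_inv_cancel_right]
      rw [← rep_mul_apply, ← h3, rep_mul_apply, hπ r hr]
      rfl
    rw [sub_sub_sub_cancel_right]
    simp only [hb]
    rw [sub_sub_sub_cancel_right, h2, ← map_sub, LinearIsometryEquiv.norm_map, norm_sub_rev]
  have hrep : 2 * ∑ r ∈ R, ‖b r.2.1‖ ^ 2 ≤ (1 - ε)⁻¹ * Q := by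
    have h1 : 2 * ∑ r ∈ R, ‖b r.2.1‖ ^ 2 = ∑ w ∈ verts R, (rep R w : ℝ) * ‖b w‖ ^ 2 := by
      rw [sum_rep_mul, Finset.mul_sum]
      exact Finset.sum_congr rfl fun r _ => by rw [hbinv, two_mul]
    have h2 := sum_smul_eval (R := R) (T := T) (fun w => (rep R w : ℝ))
      fun g => ‖π g u - u‖ ^ 2
    have h3 := sum_smul_eval (R := R) (T := T) (fun w => (deg R w : ℝ))
      fun g => ‖π g u - u‖ ^ 2
    simp only [smul_eq_mul, ← Nat.cast_sum] at h2 h3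
    rw [h1, hQ, h2, h3, Finset.mul_sum]
    refine Finset.sum_le_sum fun g hg => ?_
    have h4 := (abs_le.1 (hdeg g (Finset.mem_image.1 hg)).2).1
    rw [← mul_assoc]
    refine mul_le_mul_of_nonneg_right ?_ (sq_nonneg _)
    rw [inv_mul_eq_div, le_div_iff₀ (by linarith)]
    simp only [degElt, repElt] at h4
    linarith
  -- The approximate symmetry of `deg` on group elements, followed by Cauchy–Schwarz, shows that
  -- symmetrising moves the weighted sum only slightly.
  have hdiff : ‖B - B'‖ ^ 2 ≤ ε ^ 2 / 4 * (D * Q) := by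
    have h1 : B - B' = ∑ w ∈ verts R,
        (((deg R w : ℝ) - deg R (FreeGroup.invRev w)) / 2) • b w := by
      rw [hB, hB', ← Finset.sum_sub_distrib]
      refine Finset.sum_congr rfl fun w _ => ?_
      rw [← sub_smul]
      congr 1
      ring
    have h2 : ‖B - B'‖ ≤ ε / 2 * ∑ w ∈ verts R, (deg R w : ℝ) * ‖b w‖ := by
      have h3 := sum_smul_eval (R := R) (T := T) (fun w => (deg R (FreeGroup.invRev w) : ℝ))
        fun g => ‖π g u - u‖
      have h4 := sum_deg_invRev_mul (R := R) fun w => ‖b w‖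
      simp only [hbinv] at h4
      rw [← h4]
      simp only [smul_eq_mul] at h3
      rw [h1, h3, hb, sum_smul_eval (fun w => ((deg R w : ℝ) - deg R (FreeGroup.invRev w)) / 2)
        fun g => π g u - u, Finset.mul_sum]
      refine (norm_sum_le _ _).trans (Finset.sum_le_sum fun g hg => ?_)
      rw [norm_smul, ← mul_assoc]
      refine mul_le_mul_of_nonneg_right ?_ (norm_nonneg _)
      have h5 := (hdeg g (Finset.mem_image.1 hg)).1
      rw [degElt_inv, degElt, Nat.cast_sum, ← Finset.sum_sub_distrib] at h5
      rw [← Finset.sum_div, Real.norm_eq_abs, abs_div, abs_of_pos (zero_lt_two' ℝ)]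
      linarith
    have h6 : (∑ w ∈ verts R, (deg R w : ℝ) * ‖b w‖) ^ 2 ≤ D * Q :=
      Finset.sum_sq_le_sum_mul_sum_of_sq_le_mul _ (fun w _ => Nat.cast_nonneg _)
        (fun w _ => by positivity) fun w _ => le_of_eq (by ring)
    calc ‖B - B'‖ ^ 2 ≤ (ε / 2 * ∑ w ∈ verts R, (deg R w : ℝ) * ‖b w‖) ^ 2 :=
          pow_le_pow_left₀ (norm_nonneg _) h2 2
      _ = ε ^ 2 / 4 * (∑ w ∈ verts R, (deg R w : ℝ) * ‖b w‖) ^ 2 := by ring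
      _ ≤ _ := mul_le_mul_of_nonneg_left h6 (by positivity)
  have hB2 : ‖B‖ ^ 2 ≤ 2 * ‖B'‖ ^ 2 + ε ^ 2 / 2 * (D * Q) := by
    have h1 : ‖B‖ ≤ ‖B'‖ + ‖B - B'‖ := by
      calc ‖B‖ = ‖B' + (B - B')‖ := by rw [add_sub_cancel]
        _ ≤ _ := norm_add_le _ _
    have h2 := pow_le_pow_left₀ (norm_nonneg _) h1 2
    nlinarith [sq_nonneg (‖B'‖ - ‖B - B'‖)]
  have h7 : lambdaOne R * (Q - ‖B‖ ^ 2 / D) ≤ (2 * (1 - ε))⁻¹ * Q := by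
    rw [mul_inv]
    linarith
  have h8 := mul_le_mul_of_nonneg_right h7 hDpos.le
  have h9 : lambdaOne R * (Q - ‖B‖ ^ 2 / D) * D = lambdaOne R * (Q * D - ‖B‖ ^ 2) := by
    field_simp
  rw [h9] at h8
  have h10 := mul_le_mul_of_nonneg_left hB2 hpos.le
  nlinarith

theorem exists_near_fixed_by_verts [CompleteSpace H] {ε : ℝ} (hε0 : 0 < ε) (hε1 : ε < 1)
    (hpos : 0 < lambdaOne R) (hlam : (2 * (1 - ε))⁻¹ < lambdaOne R * (1 - ε ^ 2 / 2))
    (hdeg : ∀ g : PresentedGroup T, (∃ w ∈ verts R, eval T w = g) →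
        |(degElt R T g : ℝ) - degElt R T g⁻¹| ≤ ε * degElt R T g⁻¹ ∧
        |(degElt R T g : ℝ) - repElt R T g| ≤ ε * repElt R T g)
    (π : PresentedGroup T →* (H ≃ₗᵢ[ℝ] H)) (hπ : ∀ r ∈ R, π (eval T r.concat) = 1) :
    ∃ C : ℝ, 0 ≤ C ∧ ∀ (u : H) (δ : ℝ), (∀ w ∈ verts R, ‖π (eval T w) u - u‖ ≤ δ) →
      ∃ v, (∀ w ∈ verts R, π (eval T w) v = v) ∧ ‖u - v‖ ≤ C * δ := by
  set D := ∑ w ∈ verts R, (deg R w : ℝ) with hD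
  have hDpos : 0 < D := sum_deg_pos hpos
  set κ := lambdaOne R * (1 - ε ^ 2 / 2) - (2 * (1 - ε))⁻¹ with hκ
  have hκpos : 0 < κ := sub_pos.2 hlam
  -- Symmetrised degrees, normalised to total mass `1`, make the random walk symmetric. They give
  -- the same average as `deg` on inversion-invariant functions (`hsum`).
  let a : Word S → ℝ := fun w => D⁻¹ * (((deg R w : ℝ) + deg R (FreeGroup.invRev w)) / 2)
  have hann : ∀ w, 0 ≤ a w := fun w => by positivity
  have hsum : ∀ F : Word S → ℝ, (∀ w, F (FreeGroup.invRev w) = F w) →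
      ∑ w ∈ verts R, a w * F w = D⁻¹ * ∑ w ∈ verts R, (deg R w : ℝ) * F w := by
    intro F hF
    have h := sum_deg_invRev_mul (R := R) F
    simp only [hF] at h
    simp only [a, mul_assoc, ← Finset.mul_sum]
    congr 1
    simp only [add_div, add_mul, Finset.sum_add_distrib, div_mul_eq_mul_div, ← Finset.sum_div]
    rw [h]
    ring
  have ha1 : ∑ w ∈ verts R, a w = 1 := by
    have := hsum (fun _ => 1) fun _ => rfl
    simp only [mul_one] at this
    rw [this, ← hD, inv_mul_cancel₀ hDpos.ne']
  have hinv : ∀ (u : H) (w : Word S),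
      ‖π (eval T (FreeGroup.invRev w)) u - u‖ ^ 2 = ‖π (eval T w) u - u‖ ^ 2 := fun u w => by
    rw [eval_invRev, norm_apply_inv_sub]
  obtain ⟨C, hC, h⟩ := exists_near_fixed_vector π (verts R) (eval T) FreeGroup.invRev
    (fun _ => FreeGroup.invRev_invRev) (fun _ => invRev_mem_verts) (eval_invRev T) a
    (fun w _ => hann w) (fun w _ => by simp only [a, FreeGroup.invRev_invRev, add_comm]) ha1
    (c := κ / (2 * lambdaOne R)) (by positivity) (fun u => by
      have key := mul_sum_deg_le hε0 hε1 hpos hdeg π hπ u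
      rw [hsum _ (hinv u)]
      simp only [a, ← smul_smul, ← Finset.smul_sum]
      rw [norm_smul, mul_pow, Real.norm_of_nonneg (inv_nonneg.2 hDpos.le)]
      rw [← hκ, ← hD] at key
      rw [div_mul_eq_mul_div, div_le_iff₀ (by positivity)]
      have := mul_le_mul_of_nonneg_left key (sq_nonneg D⁻¹)
      calc _ = D⁻¹ ^ 2 * (κ * D * ∑ w ∈ verts R, (deg R w : ℝ) * ‖π (eval T w) u - u‖ ^ 2) := by
            field_simp
        _ ≤ _ := this
        _ = _ := by ring)
  refine ⟨C, hC, fun u δ hδ => ?_⟩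
  obtain ⟨v, hv, huv⟩ := h u
  have hfix : ∀ w ∈ verts R, 0 < deg R w → π (eval T w) v = v := fun w hw hdw =>
    hv w hw (by positivity)
  refine ⟨v, fun w hw => ?_, huv.trans (mul_le_mul_of_nonneg_left ?_ hC)⟩
  · have hinvfix : ∀ w : Word S, π (eval T (FreeGroup.invRev w)) v = v → π (eval T w) v = v := by
      intro w hw
      rw [eval_invRev] at hw
      conv_lhs => rw [← hw]
      exact rep_apply_inv_apply π _ v
    -- A middle word may have degree `0`, hence weight `0`. It still fixes `v`, because `x`, `z` and
    -- `xyz` do.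
    have hr : ∀ r ∈ R, π (eval T r.1) v = v ∧ π (eval T r.2.1) v = v ∧ π (eval T r.2.2) v = v := by
      intro r hr
      have hx := hfix _ (fst_mem_verts hr) (deg_fst_pos hr)
      have hz := hinvfix _ (hfix _ (invRev_mem_verts (thd_mem_verts hr)) (deg_invRev_thd_pos hr))
      refine ⟨hx, (π (eval T r.1)).injective ?_, hz⟩
      have h1 : π (eval T r.concat) v = v := by rw [hπ r hr]; rfl
      rw [Triple.concat, eval_append, eval_append, rep_mul_apply, hz, rep_mul_apply] at h1
      rw [h1, hx]
    obtain ⟨r, hrR, (h | h | h) | (h | h | h)⟩ := exists_triple_of_mem_verts hw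
    · exact h ▸ (hr r hrR).1
    · exact h ▸ (hr r hrR).2.1
    · exact h ▸ (hr r hrR).2.2
    · exact hinvfix w (h ▸ (hr r hrR).1)
    · exact hinvfix w (h ▸ (hr r hrR).2.1)
    · exact hinvfix w (h ▸ (hr r hrR).2.2)
  · have hδ0 : 0 ≤ δ := by
      have hne : (verts R).Nonempty := by
        by_contra h
        rw [Finset.not_nonempty_iff_eq_empty] at h
        simp [hD, h] at hDpos
      obtain ⟨w, hw⟩ := hne
      exact (norm_nonneg _).trans (hδ w hw)
    refine Real.sqrt_le_iff.2 ⟨hδ0, ?_⟩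
    calc _ ≤ ∑ w ∈ verts R, a w * δ ^ 2 := Finset.sum_le_sum fun w hw =>
          mul_le_mul_of_nonneg_left (pow_le_pow_left₀ (norm_nonneg _) (hδ w hw) 2) (hann w)
      _ = δ ^ 2 := by rw [← Finset.sum_mul, ha1, one_mul]

end Criterion

/-! ### From the spectral gap to Property (T). -/

/-- A unitary representation viewed as an orthogonal representation on the underlying real
Hilbert space. -/
noncomputable def realRep {Γ H : Type*} [Group Γ] [NormedAddCommGroup H] [InnerProductSpace ℂ H]
    [InnerProductSpace ℝ H] [IsScalarTower ℝ ℂ H] (π : Γ →* (H ≃ₗᵢ[ℂ] H)) :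
    Γ →* (H ≃ₗᵢ[ℝ] H) where
  toFun g := { (π g).toLinearEquiv.restrictScalars ℝ with norm_map' := (π g).norm_map }
  map_one' := by ext u; simp
  map_mul' g h := by ext u; exact rep_mul_apply π g h u

/-- The spectral criterion for Property (T) of `G / ⟨⟨xyz : (x, y, z) ∈ R⟩⟩`. -/
theorem hasPropertyT_relatorQuotient {S : Type u} [DecidableEq S] {T : Set (FreeGroup S)}
    {R : Finset (Triple S)} {ε : ℝ} (hε0 : 0 < ε) (hε1 : ε < 1) (hpos : 0 < lambdaOne R)
    (hlam : (2 * (1 - ε))⁻¹ < lambdaOne R * (1 - ε ^ 2 / 2))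
    (hdeg : ∀ g : PresentedGroup T, (∃ w ∈ verts R, eval T w = g) →
        |(degElt R T g : ℝ) - degElt R T g⁻¹| ≤ ε * degElt R T g⁻¹ ∧
        |(degElt R T g : ℝ) - repElt R T g| ≤ ε * repElt R T g)
    {A : Set (Word S)} (hA : ∀ w ∈ A, w ∈ verts R)
    (hfin : (Subgroup.closure (eval T '' A)).FiniteIndex) :
    HasPropertyT.{v} (RelatorQuotient T R) := by
  classical
  intro H _ _ _ π hπ
  let _ : InnerProductSpace ℝ H := InnerProductSpace.complexToReal
  let q : PresentedGroup T →* RelatorQuotient T R := QuotientGroup.mk' _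
  have hq : Function.Surjective q := QuotientGroup.mk'_surjective _
  obtain ⟨C, hC, h⟩ := exists_near_fixed_by_verts hε0 hε1 hpos hlam hdeg
    ((realRep π).comp q) (fun r hr => by
      have : q (eval T r.concat) = 1 :=
        (QuotientGroup.eq_one_iff _).2 (Subgroup.subset_normalClosure ⟨r, hr, rfl⟩)
      rw [MonoidHom.comp_apply, this, map_one])
  let K := (Subgroup.closure (eval T '' A)).map q
  have : K.FiniteIndex :=
    ⟨fun h0 => hfin.index_ne_zero (Nat.eq_zero_of_zero_dvd (h0 ▸ Subgroup.index_map_dvd _ hq))⟩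
  refine exists_invariant_of_finiteIndex π hπ K ((verts R).image fun w => q (eval T w)) hC
    fun u δ hδ => ?_
  obtain ⟨v, hv, huv⟩ := h u δ fun w hw => hδ _ (Finset.mem_image_of_mem _ hw)
  refine ⟨v, ?_, huv⟩
  let St : Subgroup (PresentedGroup T) :=
    { carrier := {g | π (q g) v = v}
      one_mem' := by
        change π (q 1) v = v
        rw [map_one, map_one]
        rfl
      mul_mem' := fun {g k} hg hk => by
        change π (q (g * k)) v = v
        rw [map_mul, rep_mul_apply, show π (q k) v = v from hk]
        exact hg
      inv_mem' := fun {g} hg => by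
        change π (q g⁻¹) v = v
        conv_lhs => rw [← show π (q g) v = v from hg]
        rw [← rep_mul_apply, ← map_mul, inv_mul_cancel, map_one, map_one]
        rfl }
  have hle : Subgroup.closure (eval T '' A) ≤ St := by
    rw [Subgroup.closure_le]
    rintro _ ⟨w, hw, rfl⟩
    exact hv w (hA w hw)
  rintro _ ⟨g, hg, rfl⟩
  exact hle hg

/-- At `ε = 0` the last inequality reads `1 / 2 < c`, and it persists nearby by continuity. -/
theorem exists_pos_lt_one_inv_lt {c : ℝ} (hc : 1 / 2 < c) :
    ∃ ε : ℝ, 0 < ε ∧ ε < 1 ∧ (2 * (1 - ε))⁻¹ < c * (1 - ε ^ 2 / 2) := by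
  have h1 : ContinuousAt (fun ε : ℝ => (2 * (1 - ε))⁻¹) 0 :=
    ContinuousAt.inv₀ (by fun_prop) (by norm_num)
  have h2 : ContinuousAt (fun ε : ℝ => c * (1 - ε ^ 2 / 2)) 0 := by fun_prop
  have h3 := h1.eventually_lt h2 (by norm_num at hc ⊢; exact hc)
  obtain ⟨ε, h4, h5⟩ := ((h3.filter_mono nhdsWithin_le_nhds).and
    (Ioo_mem_nhdsGT (one_pos (α := ℝ)))).exists
  exact ⟨ε, h5.1, h5.2, h4⟩

end HypQuot

theorem mainTheorem6 {S : Type u} [Finite S] [DecidableEq S]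
    (T : Set (FreeGroup S)) (hT : T.Finite) (hG : HypQuot.IsHyperbolic T)
    (L : Language (S × Bool)) (hL : HypQuot.IsAdmissibleLanguage T L)
    (ω : ℕ → ℝ) (R : ℕ → Finset (HypQuot.Triple S))
    (hR : ∀ l : ℕ, 1 ≤ l → HypQuot.IsTripleSet L (R l))
    (hpieces : ∀ l : ℕ, 1 ≤ l → ∀ r ∈ R l, ∀ w ∈ [r.1, r.2.1, r.2.2],
      (l : ℝ) / 3 - ω l / 3 ≤ (w.length : ℝ) ∧ (w.length : ℝ) ≤ (l : ℝ) / 3 + 2)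
    (hconcat : ∀ l : ℕ, 1 ≤ l → ∀ r ∈ R l,
      (l : ℝ) - ω l ≤ (r.concat.length : ℝ) ∧ (r.concat.length : ℝ) ≤ (l : ℝ))
    (hverts : ∀ᶠ l : ℕ in atTop, ∀ w ∈ L, w.length = l / 3 → w ∈ HypQuot.verts (R l))
    (hdeg : ∀ ε : ℝ, 0 < ε → ∀ᶠ l : ℕ in atTop, ∀ g : PresentedGroup T,
      (∃ w ∈ HypQuot.verts (R l), HypQuot.eval T w = g) →
        |(HypQuot.degElt (R l) T g : ℝ) - HypQuot.degElt (R l) T g⁻¹| ≤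
            ε * HypQuot.degElt (R l) T g⁻¹ ∧
        |(HypQuot.degElt (R l) T g : ℝ) - HypQuot.repElt (R l) T g| ≤
            ε * HypQuot.repElt (R l) T g)
    (lam : ℝ) (hlim : Tendsto (fun l : ℕ => HypQuot.lambdaOne (R l)) atTop (𝓝 lam))
    (hlam : 1 / 2 < lam) :
    ∀ᶠ l : ℕ in atTop, HypQuot.HasPropertyT.{v} (HypQuot.RelatorQuotient T (R l)) := by
  -- A fixed `c` strictly between `1 / 2` and the limit lets `ε` be chosen independently of `l`. The
  -- bound `l ≥ 3` below gives `l / 3 ≥ 1`, as the finite-index condition requires.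
  obtain ⟨c, hc, hcl⟩ := exists_between hlam
  obtain ⟨ε, hε0, hε1, hε⟩ := HypQuot.exists_pos_lt_one_inv_lt hc
  filter_upwards [hverts, hdeg ε hε0, hlim.eventually_const_lt hcl, eventually_ge_atTop 3]
    with l hv hd hl hl3
  have hε2 : 0 ≤ 1 - ε ^ 2 / 2 := by nlinarith
  exact HypQuot.hasPropertyT_relatorQuotient hε0 hε1 (by linarith)
    (hε.trans_le (mul_le_mul_of_nonneg_right hl.le hε2)) hd (fun w hw => hv w hw.1 hw.2)
    (hL.finiteIndex (l / 3) (by omega))
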